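/- **Weights.** Let $\omega:[0,\infty)\to[0,\infty)$ be continuous, nondecreasing and subadditive with $\omega(0)=0$, $\int_1^\infty \omega(t)t^{-2}\,dt<\infty$ and $\omega(t)/\log(1+t)\to\infty$ as $t\to\infty$. Let $\Omega\subseteq\mathbb R^d$ be open. **Functions.** For $l>0$ put $\|f\|_l=\int_{\mathbb R^d}|\hat f(\xi)|e^{l\omega(|\xi|)}\,d\xi\in[0,\infty]$. Let $\mathcal D^{\{\omega\}}(\Omega)$ be the set of smooth $f:\mathbb R^d\to\mathbb C$ with compact support contained in $\Omega$ and $\|f\|_l<\infty$ for some $l>0$. Let $\mathcal E^{\{\omega\}}(\Omega)$ be the set of smooth $f:\Omega\to\mathbb C$ with $\varphi f\in\mathcal D^{\{\omega\}}(\Omega)$ for all $\varphi\in\mathcal D^{\{\omega\}}(\Omega)$. For a compact $K\subset\Omega$ and $l>0$ put $\|f\|_{K,l}=\inf\{\|\varphi f\|_l:\varphi\in\mathcal D^{\{\omega\}}(\Omega),\ \varphi=1\text{ on }K\}$. **Nets.** Consider nets $(g_\varepsilon)_{\varepsilon\in(0,1)}$ in $\mathcal E^{\{\omega\}}(\Omega)$;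 all $o(\cdot)$ are for $\varepsilon\to0^+$, and $K$ runs over the compact subsets of $\Omega$. - $(g_\varepsilon)$ is *moderate* if $\forall K\ \forall k>0\ \exists h>0:\ \|g_\varepsilon\|_{K,h}=o(e^{k\omega(1/\varepsilon)})$. - $(g_\varepsilon)$ is *negligible* if $\forall K\ \exists k>0\ \exists h>0:\ \|g_\varepsilon\|_{K,h}=o(e^{-k\omega(1/\varepsilon)})$. - $(g_\varepsilon)$ is *regular* if it is moderate and $\forall K\ \exists h>0\ \forall k>0:\ \|g_\varepsilon\|_{K,h}=o(e^{k\omega(1/\varepsilon)})$. A Roumieu generalized function $g=[(g_\varepsilon)]$ is the class of a moderate net modulo negligible nets. It belongs to $\mathcal G^{\{\omega\},\infty}(\Omega)$ if it is the class of a regular net. **Theorem.** Let $g=[(g_\varepsilon)]\in\mathcal G^{\{\omega\},\infty}(\Omega)$. Suppose that for every $\rho\in\mathcal D^{\{\omega\}}(\Omega)$ there is $m>0$ with $$\langle g_\varepsilon,\rho\rangle=\int_\Omega g_\varepsilon(x)\rho(x)\,dx=o\bigl(e^{-m\omega(1/\varepsilon)}\bigr)\qquad(\varepsilon\to0^+).$$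 Then $g=0$, that is, the net $(g_\varepsilon)$ is negligible. -/

import Mathlib

open MeasureTheory Filter Set
open scoped Topology ENNReal FourierTransform

noncomputable section

namespace Roumieu

/-- Weight functions, as functions on `[0, ∞)` (values at negative reals are never used):
continuous, nondecreasing, `ω 0 = 0` (hence nonnegative), subadditive,
`∫_1^∞ ω(t) / t² dt < ∞` and `ω(t) / log (1 + t) → ∞`. -/
structure IsWeight (ω : ℝ → ℝ) : Prop where
  continuousOn : ContinuousOn ω (Ici 0)
  monotoneOn : MonotoneOn ω (Ici 0)
  zero : ω 0 = 0
  subadditive : ∀ x y : ℝ, 0 ≤ x → 0 ≤ y → ω (x + y) ≤ ω x + ω y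
  integrable : IntegrableOn (fun t : ℝ => ω t / t ^ 2) (Ioi 1)
  log_growth : Tendsto (fun t : ℝ => ω t / Real.log (1 + t)) atTop atTop

/-- `ℝᵈ`. -/
abbrev Space (d : ℕ) : Type := EuclideanSpace ℝ (Fin d)

/-- `∫ |f̂(ξ)| exp (l ω(|ξ|)) dξ`, with values in `[0, ∞]`. -/
def fourierNorm {d : ℕ} (ω : ℝ → ℝ) (l : ℝ) (f : Space d → ℂ) : ℝ≥0∞ :=
  ∫⁻ ξ : Space d, ‖𝓕 f ξ‖ₑ * ENNReal.ofReal (Real.exp (l * ω ‖ξ‖))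

/-- Roumieu test functions on `Ω`, extended by zero to `ℝᵈ`. -/
def IsTest {d : ℕ} (ω : ℝ → ℝ) (Ω : Set (Space d)) (f : Space d → ℂ) : Prop :=
  ContDiff ℝ (⊤ : ℕ∞) f ∧ HasCompactSupport f ∧ tsupport f ⊆ Ω ∧
    ∃ l : ℝ, 0 < l ∧ fourierNorm ω l f < ∞

/-- Roumieu ultradifferentiable functions on `Ω`: smooth on `Ω`, and every product with a test
function is a test function. Only the values on `Ω` matter. -/
def IsUltradiff {d : ℕ} (ω : ℝ → ℝ) (Ω : Set (Space d)) (f : Space d → ℂ) : Prop :=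
  ContDiffOn ℝ (⊤ : ℕ∞) f Ω ∧ ∀ φ : Space d → ℂ, IsTest ω Ω φ → IsTest ω Ω (fun x => φ x * f x)

/-- The local seminorm `‖f‖_{K,l}`: the infimum of `fourierNorm ω l (φ f)` over the test functions
`φ` on `Ω` that are equal to `1` on `K`. -/
def localNorm {d : ℕ} (ω : ℝ → ℝ) (Ω K : Set (Space d)) (l : ℝ) (f : Space d → ℂ) : ℝ≥0∞ :=
  ⨅ (φ : Space d → ℂ) (_ : IsTest ω Ω φ ∧ ∀ x ∈ K, φ x = 1),
    fourierNorm ω l (fun x => φ x * f x)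

/-- Nets of functions. The index `ε` runs over `(0, 1)`; other values of `ε` never matter. -/
abbrev Net (d : ℕ) : Type := ℝ → Space d → ℂ

/-- All members of the net are Roumieu ultradifferentiable functions on `Ω`. -/
def IsUltradiffNet {d : ℕ} (ω : ℝ → ℝ) (Ω : Set (Space d)) (g : Net d) : Prop :=
  ∀ ε ∈ Ioo (0 : ℝ) 1, IsUltradiff ω Ω (g ε)

/-- `u ε = o(exp (k ω(1/ε)))` as `ε → 0+`, for `u` with values in `[0, ∞]` and `k` of any sign. -/
def IsLittleOExp (ω : ℝ → ℝ) (k : ℝ) (u : ℝ → ℝ≥0∞) : Prop :=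
  Tendsto (fun ε : ℝ => u ε / ENNReal.ofReal (Real.exp (k * ω (1 / ε)))) (𝓝[>] 0) (𝓝 0)

/-- Roumieu moderate nets. -/
def moderateNets {d : ℕ} (ω : ℝ → ℝ) (Ω : Set (Space d)) : Set (Net d) :=
  {g | IsUltradiffNet ω Ω g ∧ ∀ K : Set (Space d), IsCompact K → K ⊆ Ω →
    ∀ k : ℝ, 0 < k → ∃ h : ℝ, 0 < h ∧
      IsLittleOExp ω k (fun ε => localNorm ω Ω K h (g ε))}

/-- Roumieu negligible nets. -/
def negligibleNets {d : ℕ} (ω : ℝ → ℝ) (Ω : Set (Space d)) : Set (Net d) :=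
  {g | IsUltradiffNet ω Ω g ∧ ∀ K : Set (Space d), IsCompact K → K ⊆ Ω →
    ∃ k : ℝ, 0 < k ∧ ∃ h : ℝ, 0 < h ∧
      IsLittleOExp ω (-k) (fun ε => localNorm ω Ω K h (g ε))}

/-- Roumieu regular nets. -/
def regularNets {d : ℕ} (ω : ℝ → ℝ) (Ω : Set (Space d)) : Set (Net d) :=
  {g | g ∈ moderateNets ω Ω ∧ ∀ K : Set (Space d), IsCompact K → K ⊆ Ω →
    ∃ h : ℝ, 0 < h ∧ ∀ k : ℝ, 0 < k →
      IsLittleOExp ω k (fun ε => localNorm ω Ω K h (g ε))}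

/-- The class `[(g_ε)]` of a net: its coset modulo the negligible nets. -/
def genClass {d : ℕ} (ω : ℝ → ℝ) (Ω : Set (Space d)) (g : Net d) : Set (Net d) :=
  {h | h - g ∈ negligibleNets ω Ω}

/-- The regular Roumieu generalized functions on `Ω`: the classes of regular nets. -/
def regularGenFunctions {d : ℕ} (ω : ℝ → ℝ) (Ω : Set (Space d)) : Set (Set (Net d)) :=
  genClass ω Ω '' regularNets ω Ω

/-- Roumieu negligible nets of complex constants. -/
def negligibleConstants (ω : ℝ → ℝ) : Set (ℝ → ℂ) :=
  {c | ∃ m : ℝ, 0 < m ∧ IsLittleOExp ω (-m) (fun ε => ‖c ε‖ₑ)}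

/-- The pairing `⟨f, ρ⟩ = ∫_Ω f ρ`. -/
def pairing {d : ℕ} (Ω : Set (Space d)) (f ρ : Space d → ℂ) : ℂ :=
  ∫ x in Ω, f x * ρ x

end Roumieu

end

namespace Roumieu

variable {d : ℕ} {ω : ℝ → ℝ} {Ω : Set (Space d)}

/-! ### Weights -/

namespace IsWeight

theorem nonneg (hω : IsWeight ω) {t : ℝ} (ht : 0 ≤ t) : 0 ≤ ω t := by
  simpa [hω.zero] using hω.monotoneOn (mem_Ici.2 le_rfl) (mem_Ici.2 ht) ht

theorem continuous_norm (hω : IsWeight ω) : Continuous fun ξ : Space d => ω ‖ξ‖ :=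
  hω.continuousOn.comp_continuous _root_.continuous_norm fun ξ => norm_nonneg ξ

theorem norm_le_add (hω : IsWeight ω) (ξ η : Space d) : ω ‖ξ‖ ≤ ω ‖ξ + η‖ + ω ‖η‖ := by
  have h : ‖ξ‖ ≤ ‖ξ + η‖ + ‖η‖ := by simpa using norm_sub_le (ξ + η) η
  exact (hω.monotoneOn (norm_nonneg _) (by positivity : (0 : ℝ) ≤ ‖ξ + η‖ + ‖η‖) h).trans
    (hω.subadditive _ _ (norm_nonneg _) (norm_nonneg _))

theorem tendsto_atTop (hω : IsWeight ω) : Tendsto ω atTop atTop := by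
  have hlog : Tendsto (fun t : ℝ => Real.log (1 + t)) atTop atTop :=
    Real.tendsto_log_atTop.comp (tendsto_atTop_add_const_left _ _ tendsto_id)
  refine (hω.log_growth.atTop_mul_atTop₀ hlog).congr' ?_
  filter_upwards [eventually_gt_atTop 0] with t ht
  have : 0 < Real.log (1 + t) := Real.log_pos (by linarith)
  field_simp

theorem tendsto_one_div (hω : IsWeight ω) :
    Tendsto (fun ε : ℝ => ω (1 / ε)) (𝓝[>] 0) atTop := by
  simp only [one_div]
  exact hω.tendsto_atTop.comp tendsto_inv_nhdsGT_zero

/-- `exp (lω)` dominates every power. -/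
theorem exists_pow_le (hω : IsWeight ω) (n : ℕ) {l : ℝ} (hl : 0 < l) :
    ∃ B : ℝ, 0 < B ∧ ∀ t : ℝ, 0 ≤ t → (1 + t) ^ n ≤ B * Real.exp (l * ω t) := by
  obtain ⟨T, hT, hT0⟩ := ((eventually_forall_ge_atTop.2
    (hω.log_growth.eventually_ge_atTop (n / l))).and (eventually_ge_atTop (1 : ℝ))).exists
  refine ⟨(1 + T) ^ n, by positivity, fun t ht => ?_⟩
  have hT1 : 1 ≤ (1 + T) ^ n := one_le_pow₀ (by linarith)
  have he : 1 ≤ Real.exp (l * ω t) := Real.one_le_exp (mul_nonneg hl.le (hω.nonneg ht))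
  rcases le_total T t with h | h
  · have h1 := hT t h
    have hlog : 0 < Real.log (1 + t) := Real.log_pos (by linarith)
    rw [div_le_div_iff₀ hl hlog] at h1
    have h2 : (1 + t) ^ n ≤ Real.exp (l * ω t) := by
      rw [← Real.exp_log (show 0 < 1 + t by linarith), ← Real.exp_nat_mul]
      exact Real.exp_le_exp.2 (by linarith)
    nlinarith
  · have h1 : (1 + t) ^ n ≤ (1 + T) ^ n := by gcongr
    nlinarith

theorem integrable_exp_neg (hω : IsWeight ω) {c : ℝ} (hc : 0 < c) :
    Integrable fun ξ : Space d => Real.exp (-(c * ω ‖ξ‖)) := by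
  obtain ⟨B, hB, h⟩ := hω.exists_pow_le (d + 1) hc
  have hint : Integrable fun ξ : Space d => (1 + ‖ξ‖) ^ (-((d + 1 : ℕ) : ℝ)) :=
    integrable_one_add_norm (by simp)
  refine (hint.const_mul B).mono' ?_ (ae_of_all _ fun ξ => ?_)
  · exact (Real.continuous_exp.comp
      (continuous_const.mul hω.continuous_norm).neg).aestronglyMeasurable
  · rw [Real.norm_of_nonneg (Real.exp_pos _).le, Real.exp_neg,
      Real.rpow_neg (by positivity), Real.rpow_natCast]
    have := h ‖ξ‖ (norm_nonneg _)
    rw [← div_eq_mul_inv, le_div_iff₀ (by positivity), inv_mul_le_iff₀ (Real.exp_pos _)]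
    linarith

end IsWeight

/-! ### The weighted Fourier norm -/

/-- The weight `exp (l ω(|ξ|))`, with values in `[0, ∞]`. -/
noncomputable def expWeight (ω : ℝ → ℝ) (l : ℝ) (ξ : Space d) : ℝ≥0∞ :=
  ENNReal.ofReal (Real.exp (l * ω ‖ξ‖))

theorem measurable_expWeight (hω : IsWeight ω) (l : ℝ) :
    Measurable (expWeight ω l : Space d → ℝ≥0∞) :=
  (Real.continuous_exp.comp
    (continuous_const.mul hω.continuous_norm)).measurable.ennreal_ofReal

theorem expWeight_le_mul (hω : IsWeight ω) {l : ℝ} (hl : 0 ≤ l) (ξ η : Space d) :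
    expWeight ω l ξ ≤ expWeight ω l (ξ + η) * expWeight ω l η := by
  rw [expWeight, expWeight, expWeight, ← ENNReal.ofReal_mul (Real.exp_pos _).le, ← Real.exp_add,
    ← mul_add]
  gcongr
  exact hω.norm_le_add ξ η

theorem expWeight_mono (hω : IsWeight ω) {l l' : ℝ} (h : l ≤ l') (ξ : Space d) :
    expWeight ω l ξ ≤ expWeight ω l' ξ := by
  have := hω.nonneg (norm_nonneg ξ)
  rw [expWeight, expWeight]
  gcongr

theorem one_le_expWeight (hω : IsWeight ω) {l : ℝ} (hl : 0 ≤ l) (ξ : Space d) :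
    1 ≤ expWeight ω l ξ := by
  rw [expWeight, ENNReal.one_le_ofReal]
  exact Real.one_le_exp (mul_nonneg hl (hω.nonneg (norm_nonneg ξ)))

theorem fourierNorm_mono (hω : IsWeight ω) {l l' : ℝ} (h : l ≤ l') (f : Space d → ℂ) :
    fourierNorm ω l f ≤ fourierNorm ω l' f :=
  lintegral_mono fun ξ => mul_le_mul_right (expWeight_mono hω h ξ) _

theorem continuous_fourier {f : Space d → ℂ} (hf : Integrable f) : Continuous (𝓕 f) :=
  VectorFourier.fourierIntegral_continuous Real.continuous_fourierChar
    (by exact continuous_inner) hf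

theorem integral_fourier_mul {f g : Space d → ℂ} (hf : Integrable f) (hg : Integrable g) :
    ∫ ξ, 𝓕 f ξ * g ξ = ∫ x, f x * 𝓕 g x := by
  have := VectorFourier.integral_fourierIntegral_smul_eq_flip (L := innerₗ (Space d))
    (μ := volume) (ν := volume) Real.continuous_fourierChar continuous_inner hf hg
  rw [flip_innerₗ] at this
  exact this

theorem integrable_fourier (hω : IsWeight ω) {l : ℝ} (hl : 0 ≤ l) {f : Space d → ℂ}
    (hf : Integrable f) (h : fourierNorm ω l f < ∞) : Integrable (𝓕 f) := by
  refine ⟨(continuous_fourier hf).aestronglyMeasurable, lt_of_le_of_lt ?_ h⟩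
  exact lintegral_mono fun ξ => le_mul_of_one_le_right' (one_le_expWeight hω hl ξ)

theorem fourierNorm_add_le (hω : IsWeight ω) (l : ℝ) {f g : Space d → ℂ}
    (hf : Integrable f) (hg : Integrable g) :
    fourierNorm ω l (fun x => f x + g x) ≤ fourierNorm ω l f + fourierNorm ω l g := by
  have h : 𝓕 (fun x => f x + g x) = fun ξ => 𝓕 f ξ + 𝓕 g ξ :=
    (VectorFourier.fourierIntegral_add Real.continuous_fourierChar
      (by exact continuous_inner) hf hg)
  have hm : Measurable fun ξ => ‖𝓕 f ξ‖ₑ * expWeight ω l ξ :=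
    (continuous_fourier hf).measurable.enorm.mul (measurable_expWeight hω l)
  unfold fourierNorm
  rw [h]
  refine le_trans ?_ (lintegral_add_left hm _).le
  refine lintegral_mono fun ξ => ?_
  change ‖𝓕 f ξ + 𝓕 g ξ‖ₑ * expWeight ω l ξ ≤
    ‖𝓕 f ξ‖ₑ * expWeight ω l ξ + ‖𝓕 g ξ‖ₑ * expWeight ω l ξ
  rw [← add_mul]
  exact mul_le_mul_left (enorm_add_le _ _) _

theorem fourierNorm_neg (l : ℝ) (f : Space d → ℂ) :
    fourierNorm ω l (fun x => -f x) = fourierNorm ω l f := by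
  have h : 𝓕 (fun x => -f x) = fun ξ => -𝓕 f ξ := by
    ext ξ
    simp only [Real.fourier_eq, smul_neg, integral_neg]
  unfold fourierNorm
  simp only [h, enorm_neg]

theorem fourier_mul_fourier {φ b : Space d → ℂ} (hφ : Integrable φ) (hb : Integrable b)
    (ξ : Space d) :
    𝓕 (fun x => φ x * 𝓕 b x) ξ = ∫ η, 𝓕 φ (ξ + η) * b η := by
  have hmod : Integrable fun x : Space d => Real.fourierChar (-inner ℝ x ξ) • φ x :=
    (Real.fourierIntegral_convergent_iff ξ).2 hφ
  have h1 : ∀ η, 𝓕 (fun x : Space d => Real.fourierChar (-inner ℝ x ξ) • φ x) η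
      = 𝓕 φ (ξ + η) := by
    intro η
    simp only [Real.fourier_eq]
    congr 1 with x
    rw [smul_smul, ← AddChar.map_add_eq_mul, inner_add_right]
    congr 3
    ring
  simp only [← h1]
  rw [integral_fourier_mul hmod hb, Real.fourier_eq]
  congr 1 with x
  rw [smul_mul_assoc]

theorem fourierNorm_mul_fourier_le (hω : IsWeight ω) {l : ℝ} (hl : 0 ≤ l) {φ b : Space d → ℂ}
    (hφ : Integrable φ) (hb : Integrable b) :
    fourierNorm ω l (fun x => φ x * 𝓕 b x) ≤
      fourierNorm ω l φ * ∫⁻ η, ‖b η‖ₑ * expWeight ω l η := by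
  have hF := (continuous_fourier hφ).measurable.enorm
  have hw := measurable_expWeight (d := d) hω l
  have hFw : Measurable fun ξ => ‖𝓕 φ ξ‖ₑ * expWeight ω l ξ := hF.mul hw
  have hbm := hb.aestronglyMeasurable.enorm
  calc fourierNorm ω l (fun x => φ x * 𝓕 b x)
      ≤ ∫⁻ ξ, ∫⁻ η, (‖𝓕 φ (ξ + η)‖ₑ * expWeight ω l (ξ + η)) * (‖b η‖ₑ * expWeight ω l η) := by
        refine lintegral_mono fun ξ => ?_
        simp only [fourier_mul_fourier hφ hb]
        refine (mul_le_mul_left (enorm_integral_le_lintegral_enorm _) _).trans ?_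
        change _ * expWeight ω l ξ ≤ _
        rw [← lintegral_mul_const' (expWeight ω l ξ) _ ENNReal.ofReal_ne_top]
        refine lintegral_mono fun η => ?_
        rw [enorm_mul]
        calc _ ≤ ‖𝓕 φ (ξ + η)‖ₑ * ‖b η‖ₑ * (expWeight ω l (ξ + η) * expWeight ω l η) :=
              mul_le_mul_right (expWeight_le_mul hω hl ξ η) _
          _ = _ := by ring
    _ = ∫⁻ η, ∫⁻ ξ, (‖𝓕 φ (ξ + η)‖ₑ * expWeight ω l (ξ + η)) * (‖b η‖ₑ * expWeight ω l η) := by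
        refine lintegral_lintegral_swap ?_
        exact (hFw.comp measurable_add).aemeasurable.mul
          (hbm.mul hw.aemeasurable).comp_snd
    _ = ∫⁻ η, fourierNorm ω l φ * (‖b η‖ₑ * expWeight ω l η) := by
        refine lintegral_congr fun η => ?_
        rw [lintegral_mul_const _ (by exact hFw.comp (measurable_add_const η)),
          lintegral_add_right_eq_self (fun ξ => ‖𝓕 φ ξ‖ₑ * expWeight ω l ξ)]
        rfl
    _ = _ := lintegral_const_mul'' _ (hbm.mul hw.aemeasurable)

/-- The weighted Fourier norms are submultiplicative. -/
theorem fourierNorm_mul_le (hω : IsWeight ω) {l : ℝ} (hl : 0 ≤ l) {φ u : Space d → ℂ}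
    (hφ : Integrable φ) (hu : Integrable u) (huc : Continuous u)
    (hul : fourierNorm ω l u < ∞) :
    fourierNorm ω l (fun x => φ x * u x) ≤ fourierNorm ω l φ * fourierNorm ω l u := by
  have hFu := integrable_fourier hω hl hu hul
  have hinv : 𝓕 (𝓕⁻ u) = u := huc.fourier_fourierInv_eq hu hFu
  have hneg : 𝓕⁻ u = fun ξ => 𝓕 u (-ξ) := funext fun ξ => Real.fourierInv_eq_fourier_neg u ξ
  have hint : Integrable (𝓕⁻ u) := hneg ▸ hFu.comp_neg
  have := fourierNorm_mul_fourier_le hω hl hφ hint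
  rw [hinv] at this
  refine this.trans_eq ?_
  congr 1
  rw [fourierNorm, ← lintegral_neg_eq_self]
  simp [hneg, expWeight]

/-! ### Test functions and ultradifferentiable functions -/

namespace IsTest

theorem integrable {f : Space d → ℂ} (hf : IsTest ω Ω f) : Integrable f :=
  hf.1.continuous.integrable_of_hasCompactSupport hf.2.1

theorem neg {f : Space d → ℂ} (hf : IsTest ω Ω f) : IsTest ω Ω (fun x => -f x) := by
  obtain ⟨h1, h2, h3, l, hl, h4⟩ := hf
  have hs : tsupport (fun x => -f x) = tsupport f := by simp [tsupport, Function.support_fun_neg]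
  refine ⟨h1.neg, h2.neg, hs ▸ h3, l, hl, by rwa [fourierNorm_neg]⟩

theorem add (hω : IsWeight ω) {f g : Space d → ℂ} (hf : IsTest ω Ω f) (hg : IsTest ω Ω g) :
    IsTest ω Ω (fun x => f x + g x) := by
  have hfi := hf.integrable
  have hgi := hg.integrable
  obtain ⟨f1, f2, f3, l, hl, f4⟩ := hf
  obtain ⟨g1, g2, g3, m, hm, g4⟩ := hg
  refine ⟨f1.add g1, f2.add g2, (tsupport_add f g).trans (union_subset f3 g3), min l m,
    lt_min hl hm, (fourierNorm_add_le hω _ hfi hgi).trans_lt (ENNReal.add_lt_top.2 ⟨?_, ?_⟩)⟩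
  · exact (fourierNorm_mono hω (min_le_left _ _) f).trans_lt f4
  · exact (fourierNorm_mono hω (min_le_right _ _) g).trans_lt g4

end IsTest

theorem IsUltradiff.sub (hω : IsWeight ω) {f g : Space d → ℂ} (hf : IsUltradiff ω Ω f)
    (hg : IsUltradiff ω Ω g) : IsUltradiff ω Ω (f - g) := by
  refine ⟨hf.1.sub hg.1, fun φ hφ => ?_⟩
  have := (hf.2 φ hφ).add hω (hg.2 φ hφ).neg
  simpa only [Pi.sub_apply, mul_sub, ← sub_eq_add_neg] using this

theorem IsUltradiff.add (hω : IsWeight ω) {f g : Space d → ℂ} (hf : IsUltradiff ω Ω f)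
    (hg : IsUltradiff ω Ω g) : IsUltradiff ω Ω (f + g) := by
  refine ⟨hf.1.add hg.1, fun φ hφ => ?_⟩
  have := (hf.2 φ hφ).add hω (hg.2 φ hφ)
  simpa only [Pi.add_apply, mul_add] using this

/-! ### Exponential bounds of nets -/

/-- `exp (k ω(1/ε))`, with values in `[0, ∞]`. -/
noncomputable def netWeight (ω : ℝ → ℝ) (k ε : ℝ) : ℝ≥0∞ :=
  ENNReal.ofReal (Real.exp (k * ω (1 / ε)))

theorem eventually_mem_Ioo : ∀ᶠ ε : ℝ in 𝓝[>] 0, ε ∈ Ioo (0 : ℝ) 1 :=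
  Ioo_mem_nhdsGT one_pos

theorem netWeight_ne_zero (k ε : ℝ) : netWeight ω k ε ≠ 0 := by
  simp [netWeight, Real.exp_pos]

theorem netWeight_mono (hω : IsWeight ω) {k k' ε : ℝ} (hε : 0 < ε) (h : k ≤ k') :
    netWeight ω k ε ≤ netWeight ω k' ε := by
  have := hω.nonneg (one_div_pos.2 hε).le
  rw [netWeight, netWeight]
  gcongr

theorem IsLittleOExp.eventually_lt {k : ℝ} {u : ℝ → ℝ≥0∞} (h : IsLittleOExp ω k u) :
    ∀ᶠ ε in 𝓝[>] 0, u ε < netWeight ω k ε := by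
  filter_upwards [h.eventually_lt_const one_pos] with ε hε
  simpa using (ENNReal.div_lt_iff (Or.inl (netWeight_ne_zero k ε))
    (Or.inl ENNReal.ofReal_ne_top)).1 hε

theorem isLittleOExp_of_eventually_le (hω : IsWeight ω) {k k' : ℝ} (hk : k' < k) {C : ℝ≥0∞}
    (hC : C ≠ ∞) {u : ℝ → ℝ≥0∞} (h : ∀ᶠ ε in 𝓝[>] 0, u ε ≤ C * netWeight ω k' ε) :
    IsLittleOExp ω k u := by
  have hlim : Tendsto (fun ε : ℝ => C * netWeight ω (k' - k) ε) (𝓝[>] 0) (𝓝 0) := by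
    have h1 : Tendsto (fun ε : ℝ => Real.exp ((k' - k) * ω (1 / ε))) (𝓝[>] 0) (𝓝 0) :=
      Real.tendsto_exp_atBot.comp (hω.tendsto_one_div.const_mul_atTop_of_neg (by linarith))
    have h2 := ENNReal.Tendsto.const_mul (ENNReal.tendsto_ofReal h1) (Or.inr hC)
    rwa [ENNReal.ofReal_zero, mul_zero] at h2
  refine tendsto_of_tendsto_of_tendsto_of_le_of_le' tendsto_const_nhds hlim
    (Eventually.of_forall fun _ => zero_le) ?_
  filter_upwards [h] with ε hε
  refine ENNReal.div_le_of_le_mul (hε.trans_eq ?_)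
  change _ = C * netWeight ω (k' - k) ε * netWeight ω k ε
  rw [mul_assoc]
  congr 1
  rw [netWeight, netWeight, netWeight, ← ENNReal.ofReal_mul (Real.exp_pos _).le, ← Real.exp_add]
  congr 2
  ring

/-! ### Negligible and regular nets, in terms of fixed test functions -/

/-- Every compact subset of `Ω` has a test function equal to `1` on it. -/
def HasCutoffs (ω : ℝ → ℝ) (Ω : Set (Space d)) : Prop :=
  ∀ K : Set (Space d), IsCompact K → K ⊆ Ω → ∃ φ : Space d → ℂ, IsTest ω Ω φ ∧ ∀ x ∈ K, φ x = 1

/-- Negligibility of all products with a fixed test function. -/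
def TestNegligible (ω : ℝ → ℝ) (Ω : Set (Space d)) (g : Net d) : Prop :=
  ∀ φ : Space d → ℂ, IsTest ω Ω φ → ∃ k : ℝ, 0 < k ∧ ∃ h : ℝ, 0 < h ∧ ∃ C : ℝ≥0∞, C ≠ ∞ ∧
    ∀ᶠ ε in 𝓝[>] 0, fourierNorm ω h (fun x => φ x * g ε x) ≤ C * netWeight ω (-k) ε

/-- Regularity of all products with a fixed test function. -/
def TestRegular (ω : ℝ → ℝ) (Ω : Set (Space d)) (g : Net d) : Prop :=
  ∀ φ : Space d → ℂ, IsTest ω Ω φ → ∃ h : ℝ, 0 < h ∧ ∀ k : ℝ, 0 < k → ∃ C : ℝ≥0∞, C ≠ ∞ ∧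
    ∀ᶠ ε in 𝓝[>] 0, fourierNorm ω h (fun x => φ x * g ε x) ≤ C * netWeight ω k ε

theorem hasCutoffs_of_mem_moderateNets {g : Net d} (hg : g ∈ moderateNets ω Ω) :
    HasCutoffs ω Ω := by
  intro K hK hKΩ
  obtain ⟨h, -, ho⟩ := hg.2 K hK hKΩ 1 one_pos
  obtain ⟨ε, hε⟩ := ho.eventually_lt.exists
  obtain ⟨φ, hφ⟩ := iInf_lt_iff.1 hε
  obtain ⟨h1, -⟩ := iInf_lt_iff.1 hφ
  exact ⟨φ, h1⟩

theorem fourierNorm_mul_le_of_localNorm_lt (hω : IsWeight ω) {f φ : Space d → ℂ}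
    (hf : IsUltradiff ω Ω f) (hφ : IsTest ω Ω φ) {h l : ℝ} (hl : 0 ≤ l) (hlh : l ≤ h)
    {M : ℝ≥0∞} (hM : localNorm ω Ω (tsupport φ) h f < M) :
    fourierNorm ω l (fun x => φ x * f x) ≤ fourierNorm ω l φ * M := by
  obtain ⟨ψ, hψ⟩ := iInf_lt_iff.1 hM
  obtain ⟨⟨hψt, hψ1⟩, hlt⟩ := iInf_lt_iff.1 hψ
  have hlM : fourierNorm ω l (fun x => ψ x * f x) < M := (fourierNorm_mono hω hlh _).trans_lt hlt
  have heq : (fun x => φ x * f x) = fun x => φ x * (ψ x * f x) := by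
    ext x
    by_cases hx : x ∈ tsupport φ
    · rw [hψ1 x hx, one_mul]
    · simp [image_eq_zero_of_notMem_tsupport hx]
  have hu := hf.2 ψ hψt
  rw [heq]
  exact (fourierNorm_mul_le hω hl hφ.integrable hu.integrable hu.1.continuous
    (hlM.trans_le le_top)).trans (mul_le_mul_right hlM.le _)

theorem eventually_fourierNorm_le (hω : IsWeight ω) {g : Net d} (hg : IsUltradiffNet ω Ω g)
    {φ : Space d → ℂ} (hφ : IsTest ω Ω φ) {h k l : ℝ} (hl : 0 ≤ l) (hlh : l ≤ h)
    (ho : IsLittleOExp ω k fun ε => localNorm ω Ω (tsupport φ) h (g ε)) :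
    ∀ᶠ ε in 𝓝[>] 0,
      fourierNorm ω l (fun x => φ x * g ε x) ≤ fourierNorm ω l φ * netWeight ω k ε := by
  filter_upwards [ho.eventually_lt, eventually_mem_Ioo] with ε h1 h2
  exact fourierNorm_mul_le_of_localNorm_lt hω (hg ε h2) hφ hl hlh h1

theorem testNegligible_of_mem_negligibleNets (hω : IsWeight ω) {g : Net d}
    (hg : g ∈ negligibleNets ω Ω) : TestNegligible ω Ω g := by
  intro φ hφ
  obtain ⟨-, h2, h3, l, hl, h4⟩ := id hφ
  obtain ⟨k, hk, h, hh, ho⟩ := hg.2 _ h2 h3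
  exact ⟨k, hk, min l h, lt_min hl hh, _,
    ((fourierNorm_mono hω (min_le_left l h) φ).trans_lt h4).ne,
    eventually_fourierNorm_le hω hg.1 hφ (lt_min hl hh).le (min_le_right l h) ho⟩

theorem testRegular_of_mem_regularNets (hω : IsWeight ω) {g : Net d}
    (hg : g ∈ regularNets ω Ω) : TestRegular ω Ω g := by
  intro φ hφ
  obtain ⟨-, h2, h3, l, hl, h4⟩ := id hφ
  obtain ⟨h, hh, ho⟩ := hg.2 _ h2 h3
  exact ⟨min l h, lt_min hl hh, fun k hk => ⟨_,
    ((fourierNorm_mono hω (min_le_left l h) φ).trans_lt h4).ne,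
    eventually_fourierNorm_le hω hg.1.1 hφ (lt_min hl hh).le (min_le_right l h) (ho k hk)⟩⟩

theorem mem_negligibleNets_of_testNegligible (hω : IsWeight ω) (hcut : HasCutoffs ω Ω) {g : Net d}
    (hu : IsUltradiffNet ω Ω g) (hg : TestNegligible ω Ω g) : g ∈ negligibleNets ω Ω := by
  refine ⟨hu, fun K hK hKΩ => ?_⟩
  obtain ⟨φ, hφ, hφ1⟩ := hcut K hK hKΩ
  obtain ⟨k, hk, h, hh, C, hC, hev⟩ := hg φ hφ
  refine ⟨k / 2, half_pos hk, h, hh,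
    isLittleOExp_of_eventually_le hω (by linarith) hC (hev.mono fun ε hε => le_trans ?_ hε)⟩
  exact iInf₂_le φ ⟨hφ, hφ1⟩

theorem eventually_fourierNorm_add_le (hω : IsWeight ω) {f g : Net d}
    (hf : IsUltradiffNet ω Ω f) (hg : IsUltradiffNet ω Ω g) {φ : Space d → ℂ}
    (hφ : IsTest ω Ω φ) {hf' hg' k m : ℝ} {C D : ℝ≥0∞}
    (hfe : ∀ᶠ ε in 𝓝[>] 0, fourierNorm ω hf' (fun x => φ x * f ε x) ≤ C * netWeight ω k ε)
    (hge : ∀ᶠ ε in 𝓝[>] 0, fourierNorm ω hg' (fun x => φ x * g ε x) ≤ D * netWeight ω m ε) :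
    ∀ᶠ ε in 𝓝[>] 0, fourierNorm ω (min hf' hg') (fun x => φ x * (f + g) ε x) ≤
      (C + D) * netWeight ω (max k m) ε := by
  filter_upwards [hfe, hge, eventually_mem_Ioo] with ε h1 h2 h3
  have := fourierNorm_add_le hω (min hf' hg') ((hf ε h3).2 φ hφ).integrable
    ((hg ε h3).2 φ hφ).integrable
  simp only [Pi.add_apply, mul_add, add_mul]
  refine this.trans (add_le_add ?_ ?_)
  · exact (fourierNorm_mono hω (min_le_left _ _) _).trans
      (h1.trans (mul_le_mul_right (netWeight_mono hω h3.1 (le_max_left _ _)) _))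
  · exact (fourierNorm_mono hω (min_le_right _ _) _).trans
      (h2.trans (mul_le_mul_right (netWeight_mono hω h3.1 (le_max_right _ _)) _))

theorem TestNegligible.add (hω : IsWeight ω) {f g : Net d} (hfu : IsUltradiffNet ω Ω f)
    (hgu : IsUltradiffNet ω Ω g) (hf : TestNegligible ω Ω f) (hg : TestNegligible ω Ω g) :
    TestNegligible ω Ω (f + g) := by
  intro φ hφ
  obtain ⟨k, hk, h, hh, C, hC, hev⟩ := hf φ hφ
  obtain ⟨k', hk', h', hh', C', hC', hev'⟩ := hg φ hφ
  refine ⟨min k k', lt_min hk hk', min h h', lt_min hh hh', C + C',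
    ENNReal.add_ne_top.2 ⟨hC, hC'⟩, ?_⟩
  rw [← max_neg_neg]
  exact eventually_fourierNorm_add_le hω hfu hgu hφ hev hev'

theorem TestNegligible.neg {f : Net d} (hf : TestNegligible ω Ω f) :
    TestNegligible ω Ω (-f) := by
  simpa only [TestNegligible, Pi.neg_apply, mul_neg, fourierNorm_neg] using hf

theorem TestRegular.add_testNegligible (hω : IsWeight ω) {f g : Net d}
    (hfu : IsUltradiffNet ω Ω f) (hgu : IsUltradiffNet ω Ω g) (hf : TestRegular ω Ω f)
    (hg : TestNegligible ω Ω g) : TestRegular ω Ω (f + g) := by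
  intro φ hφ
  obtain ⟨h, hh, hreg⟩ := hf φ hφ
  obtain ⟨k', hk', h', hh', C', hC', hev'⟩ := hg φ hφ
  refine ⟨min h h', lt_min hh hh', fun k hk => ?_⟩
  obtain ⟨C, hC, hev⟩ := hreg k hk
  refine ⟨C + C', ENNReal.add_ne_top.2 ⟨hC, hC'⟩, ?_⟩
  have := eventually_fourierNorm_add_le hω hfu hgu hφ hev hev'
  rwa [max_eq_left (by linarith)] at this

theorem testNegligible_zero : TestNegligible ω Ω (0 : Net d) := by
  refine fun φ _ => ⟨1, one_pos, 1, one_pos, 0, ENNReal.zero_ne_top, Eventually.of_forall fun ε => ?_⟩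
  have h : 𝓕 (fun _ : Space d => (0 : ℂ)) = fun _ => 0 := by
    ext ξ
    simp [Real.fourier_eq]
  simp [fourierNorm, h]

theorem negligibleNets_add (hω : IsWeight ω) (hcut : HasCutoffs ω Ω) {f g : Net d}
    (hf : f ∈ negligibleNets ω Ω) (hg : g ∈ negligibleNets ω Ω) : f + g ∈ negligibleNets ω Ω :=
  mem_negligibleNets_of_testNegligible hω hcut (fun ε hε => (hf.1 ε hε).add hω (hg.1 ε hε))
    ((testNegligible_of_mem_negligibleNets hω hf).add hω hf.1 hg.1
      (testNegligible_of_mem_negligibleNets hω hg))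

theorem negligibleNets_sub (hω : IsWeight ω) (hcut : HasCutoffs ω Ω) {f g : Net d}
    (hf : f ∈ negligibleNets ω Ω) (hg : g ∈ negligibleNets ω Ω) : f - g ∈ negligibleNets ω Ω := by
  have hng : -g ∈ negligibleNets ω Ω := by
    refine mem_negligibleNets_of_testNegligible hω hcut (fun ε hε => ?_)
      (testNegligible_of_mem_negligibleNets hω hg).neg
    have := ((hg.1 ε hε).sub hω (hg.1 ε hε)).sub hω (hg.1 ε hε)
    rwa [sub_self, zero_sub] at this
  rw [sub_eq_add_neg]
  exact negligibleNets_add hω hcut hf hng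

theorem zero_mem_negligibleNets (hω : IsWeight ω) (hcut : HasCutoffs ω Ω) {g : Net d}
    (hg : IsUltradiffNet ω Ω g) : (0 : Net d) ∈ negligibleNets ω Ω :=
  mem_negligibleNets_of_testNegligible hω hcut
    (fun ε hε => by simpa using (hg ε hε).sub hω (hg ε hε)) testNegligible_zero

/-! ### The uniform bound -/

/-- A family of functionals that decays pointwise, at a rate depending on the point, decays
uniformly on bounded sets. -/
theorem exists_uniform_decay {X : Type*} [NormedAddCommGroup X] [NormedSpace ℂ X]
    [CompleteSpace X] (T : ℝ → X →L[ℂ] ℂ) (w : ℝ → ℝ)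
    (h : ∀ a : X, ∃ n : ℕ, ∀ ε ∈ Ioo (0 : ℝ) (1 / (n + 1)),
      ‖T ε a‖ ≤ Real.exp (-(1 / (n + 1)) * w ε)) :
    ∃ n : ℕ, ∃ C : ℝ, 0 ≤ C ∧ ∀ ε ∈ Ioo (0 : ℝ) (1 / (n + 1)), ∀ a : X,
      ‖T ε a‖ ≤ C * Real.exp (-(1 / (n + 1)) * w ε) * ‖a‖ := by
  let A : ℕ → Set X := fun n =>
    ⋂ ε ∈ Ioo (0 : ℝ) (1 / (n + 1)), {a | ‖T ε a‖ ≤ Real.exp (-(1 / (n + 1)) * w ε)}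
  have hclosed : ∀ n, IsClosed (A n) := fun n =>
    isClosed_biInter fun ε _ => isClosed_le (T ε).continuous.norm continuous_const
  have hunion : ⋃ n, A n = univ := by
    refine eq_univ_of_forall fun a => mem_iUnion.2 ?_
    obtain ⟨n, hn⟩ := h a
    exact ⟨n, mem_iInter₂.2 hn⟩
  obtain ⟨n, a₀, ha₀⟩ := nonempty_interior_of_iUnion_of_closed hclosed hunion
  obtain ⟨r, hr, hball⟩ := Metric.mem_nhds_iff.1 (mem_interior_iff_mem_nhds.1 ha₀)
  refine ⟨n, 2 / (r / 2), by positivity, fun ε hε a => ?_⟩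
  have hA : ∀ b ∈ Metric.ball a₀ r, ‖T ε b‖ ≤ Real.exp (-(1 / (n + 1)) * w ε) := fun b hb =>
    mem_iInter₂.1 (hball hb) ε hε
  set E := Real.exp (-(1 / (n + 1)) * w ε)
  rcases eq_or_ne a 0 with rfl | ha
  · simp
  have hna : 0 < ‖a‖ := norm_pos_iff.2 ha
  let c : ℂ := ((r / 2 / ‖a‖ : ℝ) : ℂ)
  have hc : ‖c‖ = r / 2 / ‖a‖ := by
    rw [Complex.norm_real, Real.norm_of_nonneg (by positivity)]
  have hmem : a₀ + c • a ∈ Metric.ball a₀ r := by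
    rw [mem_ball_iff_norm, add_sub_cancel_left, norm_smul, hc, div_mul_cancel₀ _ hna.ne']
    linarith
  have h1 : ‖T ε (c • a)‖ ≤ 2 * E := by
    have h2 : T ε (c • a) = T ε (a₀ + c • a) - T ε a₀ := by simp
    rw [h2]
    linarith [norm_sub_le (T ε (a₀ + c • a)) (T ε a₀), hA _ hmem,
      hA _ (Metric.mem_ball_self hr)]
  rw [map_smul, norm_smul, hc, div_mul_eq_mul_div, div_le_iff₀ hna] at h1
  rw [div_mul_eq_mul_div, div_mul_eq_mul_div, le_div_iff₀ (by positivity)]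
  linarith

theorem exists_clm_integral_mul {G : Space d → ℂ} (hG : Continuous G) {M : ℝ}
    (hM : ∀ ξ, ‖G ξ‖ ≤ M) :
    ∃ T : (Space d →₁[volume] ℂ) →L[ℂ] ℂ, ∀ a : Space d →₁[volume] ℂ, T a = ∫ ξ, G ξ * a ξ := by
  have hint : ∀ a : Space d →₁[volume] ℂ, Integrable fun ξ => G ξ * a ξ := fun a =>
    (L1.integrable_coeFn a).bdd_mul hG.aestronglyMeasurable (ae_of_all _ hM)
  let T : (Space d →₁[volume] ℂ) →ₗ[ℂ] ℂ :=
    { toFun := fun a => ∫ ξ, G ξ * a ξ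
      map_add' := fun a b => by
        rw [← integral_add (hint a) (hint b)]
        refine integral_congr_ae ?_
        filter_upwards [Lp.coeFn_add a b] with ξ h
        rw [h, Pi.add_apply, mul_add]
      map_smul' := fun c a => by
        rw [RingHom.id_apply, ← integral_smul]
        refine integral_congr_ae ?_
        filter_upwards [Lp.coeFn_smul c a] with ξ h
        rw [h, Pi.smul_apply, mul_smul_comm] }
  refine ⟨T.mkContinuous M fun a => ?_, fun a => rfl⟩
  rw [L1.norm_eq_integral_norm, ← integral_const_mul]
  refine norm_integral_le_of_norm_le ((L1.integrable_coeFn a).norm.const_mul M)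
    (ae_of_all _ fun ξ => ?_)
  rw [norm_mul]
  gcongr
  exact hM ξ

/-- Multiplication by `exp (-l ω(|ξ|))`. -/
noncomputable def damp (ω : ℝ → ℝ) (l : ℝ) (a : Space d → ℂ) (ξ : Space d) : ℂ :=
  (Real.exp (-(l * ω ‖ξ‖)) : ℂ) * a ξ

theorem continuous_damp_factor (hω : IsWeight ω) (l : ℝ) :
    Continuous fun ξ : Space d => (Real.exp (-(l * ω ‖ξ‖)) : ℂ) :=
  Complex.continuous_ofReal.comp
    (Real.continuous_exp.comp (continuous_const.mul hω.continuous_norm).neg)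

theorem norm_damp (l : ℝ) (a : Space d → ℂ) (ξ : Space d) :
    ‖damp ω l a ξ‖ = Real.exp (-(l * ω ‖ξ‖)) * ‖a ξ‖ := by
  rw [damp, norm_mul, Complex.norm_real, Real.norm_of_nonneg (Real.exp_pos _).le]

theorem enorm_damp_mul_expWeight (l : ℝ) (a : Space d → ℂ) (ξ : Space d) :
    ‖damp ω l a ξ‖ₑ * expWeight ω l ξ = ‖a ξ‖ₑ := by
  rw [← ofReal_norm, norm_damp, expWeight, ← ENNReal.ofReal_mul (by positivity), ← ofReal_norm,
    mul_right_comm, ← Real.exp_add]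
  simp

theorem aestronglyMeasurable_damp (hω : IsWeight ω) (l : ℝ) {a : Space d → ℂ}
    (ha : AEStronglyMeasurable a) : AEStronglyMeasurable (damp ω l a) :=
  (continuous_damp_factor hω l).aestronglyMeasurable.mul ha

theorem integrable_damp_pow (hω : IsWeight ω) {l : ℝ} (hl : 0 < l) {a : Space d → ℂ}
    (ha : Integrable a) (n : ℕ) : Integrable fun ξ => ‖ξ‖ ^ n * ‖damp ω l a ξ‖ := by
  obtain ⟨B, hB, h⟩ := hω.exists_pow_le n hl
  refine (ha.norm.const_mul B).mono' ?_ (ae_of_all _ fun ξ => ?_)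
  · exact (_root_.continuous_norm.pow n).aestronglyMeasurable.mul
      (aestronglyMeasurable_damp hω l ha.1).norm
  · have h1 : ‖ξ‖ ^ n ≤ (1 + ‖ξ‖) ^ n := by gcongr; linarith
    have h2 := h1.trans (h ‖ξ‖ (norm_nonneg _))
    rw [Real.norm_of_nonneg (by positivity), norm_damp, Real.exp_neg, ← mul_assoc]
    gcongr
    rwa [← div_eq_mul_inv, div_le_iff₀ (Real.exp_pos _)]

theorem integrable_damp (hω : IsWeight ω) {l : ℝ} (hl : 0 < l) {a : Space d → ℂ}
    (ha : Integrable a) : Integrable (damp ω l a) := by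
  have h := integrable_damp_pow hω hl ha 0
  simp only [pow_zero, one_mul] at h
  exact (integrable_norm_iff (aestronglyMeasurable_damp hω l ha.1)).1 h

/-- A test function times the Fourier transform of a damped integrable function is again a test
function. -/
theorem IsTest.mul_fourier_damp (hω : IsWeight ω) {φ : Space d → ℂ} (hφ : IsTest ω Ω φ) {l : ℝ}
    (hl : 0 < l) (hφl : fourierNorm ω l φ < ∞) {a : Space d → ℂ} (ha : Integrable a) :
    IsTest ω Ω (fun x => φ x * 𝓕 (damp ω l a) x) := by
  refine ⟨hφ.1.mul ?_, hφ.2.1.mul_right, (tsupport_mul_subset_left).trans hφ.2.2.1, l, hl, ?_⟩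
  · exact Real.contDiff_fourier fun n _ => integrable_damp_pow hω hl ha n
  · refine (fourierNorm_mul_fourier_le hω hl.le hφ.integrable
      (integrable_damp hω hl ha)).trans_lt (ENNReal.mul_lt_top hφl ?_)
    simp only [enorm_damp_mul_expWeight]
    exact ha.2

theorem pairing_mul_fourier {f φ b : Space d → ℂ} (hf : IsUltradiff ω Ω f)
    (hφ : IsTest ω Ω φ) (hb : Integrable b) :
    pairing Ω f (fun x => φ x * 𝓕 b x) = ∫ ξ, 𝓕 (fun x => φ x * f x) ξ * b ξ := by
  rw [integral_fourier_mul (hf.2 φ hφ).integrable hb, pairing,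
    setIntegral_eq_integral_of_forall_compl_eq_zero]
  · congr 1 with x
    ring
  · intro x hx
    simp [image_eq_zero_of_notMem_tsupport fun h => hx (hφ.2.2.1 h)]

theorem exists_bound_of_mem_negligibleConstants (hω : IsWeight ω) {c : ℝ → ℂ}
    (hc : c ∈ negligibleConstants ω) : ∃ n : ℕ, ∀ ε ∈ Ioo (0 : ℝ) (1 / (n + 1)),
      ‖c ε‖ ≤ Real.exp (-(1 / (n + 1)) * ω (1 / ε)) := by
  obtain ⟨m, hm, ho⟩ := hc
  obtain ⟨r, hr, hev⟩ := mem_nhdsGT_iff_exists_Ioo_subset.1 ho.eventually_lt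
  obtain ⟨n, hn⟩ := exists_nat_one_div_lt (lt_min hm hr)
  refine ⟨n, fun ε hε => ?_⟩
  have h1 : ‖c ε‖ₑ < netWeight ω (-m) ε :=
    hev ⟨hε.1, hε.2.trans (hn.trans_le (min_le_right _ _))⟩
  rw [← ofReal_norm, netWeight, ENNReal.ofReal_lt_ofReal_iff (Real.exp_pos _)] at h1
  refine h1.le.trans (Real.exp_le_exp.2 ?_)
  have h2 := hω.nonneg (one_div_pos.2 hε.1).le
  have h3 := hn.le.trans (min_le_left _ _)
  nlinarith

theorem exists_uniform_fourier_bound (hω : IsWeight ω) {g : Net d} (hg : IsUltradiffNet ω Ω g)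
    (hpair : ∀ ρ : Space d → ℂ, IsTest ω Ω ρ →
      (fun ε : ℝ => pairing Ω (g ε) ρ) ∈ negligibleConstants ω)
    {φ : Space d → ℂ} (hφ : IsTest ω Ω φ) {l : ℝ} (hl : 0 < l) (hφl : fourierNorm ω l φ < ∞) :
    ∃ m : ℝ, 0 < m ∧ ∃ C : ℝ, 0 ≤ C ∧ ∀ᶠ ε in 𝓝[>] 0, ∀ a : Space d → ℂ, Integrable a →
      ‖∫ ξ, 𝓕 (fun x => φ x * g ε x) ξ * damp ω l a ξ‖ ≤
        C * Real.exp (-m * ω (1 / ε)) * ∫ ξ, ‖a ξ‖ := by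
  have hex : ∀ ε : ℝ, ∃ T : (Space d →₁[volume] ℂ) →L[ℂ] ℂ, ε ∈ Ioo (0 : ℝ) 1 →
      ∀ a : Space d →₁[volume] ℂ,
        T a = ∫ ξ, 𝓕 (fun x => φ x * g ε x) ξ * damp ω l a ξ := by
    intro ε
    by_cases hε : ε ∈ Ioo (0 : ℝ) 1
    · have hint := ((hg ε hε).2 φ hφ).integrable
      obtain ⟨T, hT⟩ := exists_clm_integral_mul
        (G := fun ξ => 𝓕 (fun x => φ x * g ε x) ξ * (Real.exp (-(l * ω ‖ξ‖)) : ℂ))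
        ((continuous_fourier hint).mul (continuous_damp_factor hω l))
        (M := ∫ x, ‖φ x * g ε x‖) (fun ξ => by
          rw [norm_mul, Complex.norm_real, Real.norm_of_nonneg (Real.exp_pos _).le]
          refine (mul_le_of_le_one_right (norm_nonneg _) ?_).trans
            (VectorFourier.norm_fourierIntegral_le_integral_norm _ _ _ _ _)
          exact Real.exp_le_one_iff.2
            (neg_nonpos.2 (mul_nonneg hl.le (hω.nonneg (norm_nonneg ξ)))))
      exact ⟨T, fun _ a => by simp only [hT, damp, mul_assoc]⟩
    · exact ⟨0, fun h => absurd h hε⟩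
  choose T hT using hex
  have hsub : ∀ n : ℕ, Ioo (0 : ℝ) (1 / (n + 1)) ⊆ Ioo 0 1 := fun n =>
    Ioo_subset_Ioo_right ((div_le_one (by positivity)).2 (by simp))
  obtain ⟨n, C, hC, hb⟩ := exists_uniform_decay T (fun ε => ω (1 / ε)) (fun a => by
    have ha := L1.integrable_coeFn a
    obtain ⟨n, hn⟩ := exists_bound_of_mem_negligibleConstants hω
      (hpair _ (hφ.mul_fourier_damp hω hl hφl ha))
    refine ⟨n, fun ε hε => ?_⟩
    have := hn ε hε
    rwa [pairing_mul_fourier (hg ε (hsub n hε)) hφ (integrable_damp hω hl ha),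
      ← hT ε (hsub n hε)] at this)
  refine ⟨1 / (n + 1), by positivity, C, hC, ?_⟩
  filter_upwards [Ioo_mem_nhdsGT (show (0 : ℝ) < 1 / (n + 1) by positivity)] with ε hε a ha
  have := hb ε hε (ha.toL1 a)
  rw [hT ε (hsub n hε), L1.norm_of_fun_eq_integral_norm] at this
  refine le_trans (le_of_eq ?_) this
  congr 1
  refine integral_congr_ae ?_
  filter_upwards [ha.coeFn_toL1] with ξ hξ
  rw [damp, damp, hξ]

/-! ### Low and high frequencies -/

theorem lintegral_low_frequencies_le (hω : IsWeight ω) {F : Space d → ℂ} (hF : Continuous F)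
    {K : ℝ} (hK : ∀ ξ, ‖F ξ‖ ≤ K) {l h M R : ℝ} (hl : 0 < l) (hh : 0 < h)
    (hb : ∀ a : Space d → ℂ, Integrable a → ‖∫ ξ, F ξ * damp ω l a ξ‖ ≤ M * ∫ ξ, ‖a ξ‖)
    (hM : 0 ≤ M) :
    ∫⁻ ξ in {ξ | ω ‖ξ‖ ≤ R}, ‖F ξ‖ₑ * expWeight ω h ξ ≤
      ENNReal.ofReal (M * (Real.exp ((h + l + 1) * R) *
        ∫ ξ : Space d, Real.exp (-(1 * ω ‖ξ‖)))) := by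
  set S : Set (Space d) := {ξ | ω ‖ξ‖ ≤ R}
  have hSm : MeasurableSet S := (isClosed_le hω.continuous_norm continuous_const).measurableSet
  let s : Space d → ℂ := fun ξ => (starRingEnd ℂ) (F ξ) / (‖F ξ‖ : ℂ)
  have hsm : Measurable s :=
    (Complex.continuous_conj.comp hF).measurable.div
      (Complex.continuous_ofReal.comp hF.norm).measurable
  have hs1 : ∀ ξ, ‖s ξ‖ ≤ 1 := fun ξ => by
    simp only [s, norm_div, RCLike.norm_conj, Complex.norm_real, norm_norm]
    exact div_self_le_one _
  have hsF : ∀ ξ, F ξ * s ξ = (‖F ξ‖ : ℂ) := fun ξ => by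
    by_cases h0 : F ξ = 0
    · simp [h0]
    · have : (‖F ξ‖ : ℂ) ≠ 0 := by simpa using h0
      simp only [s]
      rw [← mul_div_assoc, Complex.mul_conj', sq, mul_div_assoc, div_self this, mul_one]
  let a : Space d → ℂ := S.indicator fun ξ => s ξ * (Real.exp ((h + l) * ω ‖ξ‖) : ℂ)
  have hcont : Continuous fun ξ : Space d => Real.exp ((h + l) * ω ‖ξ‖) :=
    Real.continuous_exp.comp (continuous_const.mul hω.continuous_norm)
  have ham : Measurable a :=
    (hsm.mul (Complex.continuous_ofReal.comp hcont).measurable).indicator hSm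
  have hexp := (hω.integrable_exp_neg (d := d) one_pos).const_mul (Real.exp ((h + l + 1) * R))
  have hle : ∀ ξ, ‖a ξ‖ ≤ Real.exp ((h + l + 1) * R) * Real.exp (-(1 * ω ‖ξ‖)) := by
    intro ξ
    by_cases hξ : ξ ∈ S
    · have hξ' : ω ‖ξ‖ ≤ R := hξ
      simp only [a, indicator_of_mem hξ, norm_mul, Complex.norm_real,
        Real.norm_of_nonneg (Real.exp_pos _).le]
      rw [← Real.exp_add]
      refine (mul_le_of_le_one_left (Real.exp_pos _).le (hs1 ξ)).trans (Real.exp_le_exp.2 ?_)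
      nlinarith
    · simp only [a, indicator_of_notMem hξ, norm_zero]
      positivity
  have hai : Integrable a := hexp.mono' ham.aestronglyMeasurable (ae_of_all _ hle)
  let G : Space d → ℝ := S.indicator fun ξ => ‖F ξ‖ * Real.exp (h * ω ‖ξ‖)
  have hG : ∀ ξ, F ξ * damp ω l a ξ = (G ξ : ℂ) := by
    intro ξ
    by_cases hξ : ξ ∈ S
    · simp only [damp, a, G, indicator_of_mem hξ]
      calc F ξ * ((Real.exp (-(l * ω ‖ξ‖)) : ℂ) * (s ξ * (Real.exp ((h + l) * ω ‖ξ‖) : ℂ)))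
          = (F ξ * s ξ) * ((Real.exp (-(l * ω ‖ξ‖)) * Real.exp ((h + l) * ω ‖ξ‖) : ℝ) : ℂ) := by
            push_cast
            ring
        _ = _ := by
            rw [hsF, ← Real.exp_add, Complex.ofReal_mul]
            congr 4
            ring
    · simp [damp, a, G, indicator_of_notMem hξ]
  have hG0 : ∀ ξ, 0 ≤ G ξ := fun ξ => indicator_nonneg (fun ξ _ => by positivity) ξ
  have key := hb a hai
  simp only [hG] at key
  have hGint : Integrable G := by
    have hint : Integrable fun ξ => F ξ * damp ω l a ξ :=
      (integrable_damp hω hl hai).bdd_mul hF.aestronglyMeasurable (ae_of_all _ hK)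
    simpa only [hG, RCLike.re_eq_complex_re, Complex.ofReal_re] using hint.re
  rw [integral_complex_ofReal, Complex.norm_real,
    Real.norm_of_nonneg (integral_nonneg hG0)] at key
  have hlint : ∫⁻ ξ in S, ‖F ξ‖ₑ * expWeight ω h ξ = ∫⁻ ξ, ENNReal.ofReal (G ξ) := by
    rw [← lintegral_indicator hSm]
    refine lintegral_congr fun ξ => ?_
    by_cases hξ : ξ ∈ S
    · simp only [G, indicator_of_mem hξ]
      rw [ENNReal.ofReal_mul (norm_nonneg _), ofReal_norm]
      rfl
    · simp [G, indicator_of_notMem hξ]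
  rw [hlint, ← ofReal_integral_eq_lintegral_ofReal hGint (ae_of_all _ hG0)]
  refine ENNReal.ofReal_le_ofReal (key.trans ?_)
  gcongr
  rw [← integral_const_mul]
  exact integral_mono hai.norm hexp hle

theorem lintegral_high_frequencies_le (hω : IsWeight ω) (F : Space d → ℂ) {h h' R : ℝ}
    (hh : h' ≤ h) :
    ∫⁻ ξ in {ξ | ω ‖ξ‖ ≤ R}ᶜ, ‖F ξ‖ₑ * expWeight ω h' ξ ≤
      ENNReal.ofReal (Real.exp (-(h - h') * R)) * ∫⁻ ξ, ‖F ξ‖ₑ * expWeight ω h ξ := by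
  have hSm : MeasurableSet {ξ : Space d | ω ‖ξ‖ ≤ R} :=
    (isClosed_le hω.continuous_norm continuous_const).measurableSet
  rw [← lintegral_const_mul' _ _ ENNReal.ofReal_ne_top]
  refine (setLIntegral_mono' hSm.compl fun ξ hξ => ?_).trans (setLIntegral_le_lintegral _ _)
  have hξ' : R < ω ‖ξ‖ := not_le.1 hξ
  rw [mul_left_comm]
  refine mul_le_mul_right ?_ _
  rw [expWeight, expWeight, ← ENNReal.ofReal_mul (Real.exp_pos _).le, ← Real.exp_add]
  refine ENNReal.ofReal_le_ofReal (Real.exp_le_exp.2 ?_)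
  nlinarith

theorem TestRegular.testNegligible (hω : IsWeight ω) {g : Net d} (hu : IsUltradiffNet ω Ω g)
    (hg : TestRegular ω Ω g) (hpair : ∀ ρ : Space d → ℂ, IsTest ω Ω ρ →
      (fun ε : ℝ => pairing Ω (g ε) ρ) ∈ negligibleConstants ω) :
    TestNegligible ω Ω g := by
  intro φ hφ
  obtain ⟨l, hl, hφl⟩ := hφ.2.2.2
  obtain ⟨m, hm, C, hC, hlow⟩ := exists_uniform_fourier_bound hω hu hpair hφ hl hφl
  obtain ⟨h, hh, hreg⟩ := hg φ hφ
  let δ : ℝ := m / (2 * (h / 2 + l + 1))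
  have hδ : 0 < δ := by positivity
  obtain ⟨D, hD, hhigh⟩ := hreg (h / 4 * δ) (by positivity)
  let I : ℝ := ∫ ξ : Space d, Real.exp (-(1 * ω ‖ξ‖))
  have hI : 0 ≤ I := integral_nonneg fun ξ => (Real.exp_pos _).le
  refine ⟨min (m / 2) (h / 4 * δ), by positivity, h / 2, half_pos hh, ENNReal.ofReal (C * I) + D,
    ENNReal.add_ne_top.2 ⟨ENNReal.ofReal_ne_top, hD⟩, ?_⟩
  filter_upwards [hlow, hhigh, eventually_mem_Ioo] with ε h1 h2 hε
  have hF := continuous_fourier ((hu ε hε).2 φ hφ).integrable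
  set F := 𝓕 (fun x => φ x * g ε x)
  set R := δ * ω (1 / ε) with hR
  have hSm : MeasurableSet {ξ : Space d | ω ‖ξ‖ ≤ R} :=
    (isClosed_le hω.continuous_norm continuous_const).measurableSet
  have hsplit : fourierNorm ω (h / 2) (fun x => φ x * g ε x) =
      (∫⁻ ξ in {ξ | ω ‖ξ‖ ≤ R}, ‖F ξ‖ₑ * expWeight ω (h / 2) ξ) +
        ∫⁻ ξ in {ξ | ω ‖ξ‖ ≤ R}ᶜ, ‖F ξ‖ₑ * expWeight ω (h / 2) ξ :=
    (lintegral_add_compl _ hSm).symm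
  rw [hsplit, add_mul]
  have hw := hω.nonneg (one_div_pos.2 hε.1).le
  refine add_le_add ?_ ?_
  · refine (lintegral_low_frequencies_le hω hF
      (VectorFourier.norm_fourierIntegral_le_integral_norm _ _ _ _) hl (half_pos hh) h1 (by positivity)).trans ?_
    refine le_trans (le_of_eq ?_) (mul_le_mul_right
      (netWeight_mono hω hε.1 (neg_le_neg (min_le_left (m / 2) (h / 4 * δ)))) _)
    rw [netWeight, ← ENNReal.ofReal_mul (by positivity)]
    congr 1
    have hexp : Real.exp (-(m / 2) * ω (1 / ε)) =
        Real.exp (-m * ω (1 / ε)) * Real.exp ((h / 2 + l + 1) * R) := by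
      rw [← Real.exp_add]
      congr 1
      have : (h / 2 + l + 1) * δ = m / 2 := by
        simp only [δ]
        field_simp
      rw [hR, ← mul_assoc, this]
      ring
    rw [hexp]
    ring
  · refine (lintegral_high_frequencies_le hω F (half_le_self hh.le)).trans ?_
    refine (mul_le_mul_right h2 _).trans ?_
    refine le_trans (le_of_eq ?_) (mul_le_mul_right
      (netWeight_mono hω hε.1 (neg_le_neg (min_le_right (m / 2) (h / 4 * δ)))) _)
    rw [mul_left_comm, netWeight, netWeight, ← ENNReal.ofReal_mul (by positivity),
      ← Real.exp_add, hR]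
    congr 3
    ring

end Roumieu

theorem mainTheorem11 {d : ℕ} (ω : ℝ → ℝ) (hω : Roumieu.IsWeight ω)
    (Ω : Set (Roumieu.Space d)) (hΩ : IsOpen Ω)
    (G : Set (Roumieu.Net d)) (hG : G ∈ Roumieu.regularGenFunctions ω Ω)
    (g : Roumieu.Net d) (hg : g ∈ Roumieu.moderateNets ω Ω)
    (hgG : Roumieu.genClass ω Ω g = G)
    (hpair : ∀ ρ : Roumieu.Space d → ℂ, Roumieu.IsTest ω Ω ρ →
      (fun ε : ℝ => Roumieu.pairing Ω (g ε) ρ) ∈ Roumieu.negligibleConstants ω) :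
    G = Roumieu.genClass ω Ω 0 := by
  have hcut := Roumieu.hasCutoffs_of_mem_moderateNets hg
  obtain ⟨r, hr, hrG⟩ := hG
  have hgr : g - r ∈ Roumieu.negligibleNets ω Ω := by
    change g ∈ Roumieu.genClass ω Ω r
    rw [hrG, ← hgG]
    change g - g ∈ Roumieu.negligibleNets ω Ω
    rw [sub_self]
    exact Roumieu.zero_mem_negligibleNets hω hcut hg.1
  have hreg : Roumieu.TestRegular ω Ω g := by
    have := (Roumieu.testRegular_of_mem_regularNets hω hr).add_testNegligible hω hr.1.1 hgr.1
      (Roumieu.testNegligible_of_mem_negligibleNets hω hgr)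
    rwa [add_sub_cancel] at this
  have hneg : g ∈ Roumieu.negligibleNets ω Ω :=
    Roumieu.mem_negligibleNets_of_testNegligible hω hcut hg.1
      (hreg.testNegligible hω hg.1 hpair)
  rw [← hgG]
  ext f
  change f - g ∈ Roumieu.negligibleNets ω Ω ↔ f - 0 ∈ Roumieu.negligibleNets ω Ω
  rw [sub_zero]
  refine ⟨fun h => ?_, fun h => Roumieu.negligibleNets_sub hω hcut h hneg⟩
  simpa using Roumieu.negligibleNets_add hω hcut h hneg
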